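/- For integers $n\ge k\ge 0$ let $s(n,k)$ denote the (signed) Stirling numbers of the first kind, i.e. $x(x-1)\cdots(x-n+1)=\sum_{k=0}^{n}s(n,k)x^k$. For integers $k\ge1$ and $m\ge2$ put $$Q(k,m)=\sum_{\ell=0}^{m}\binom{k+\ell-1}{k-1}\,s(k+m-1,k+\ell-1)\Bigl(\frac{k+m-2}{2}\Bigr)^{\ell},$$ and for $\alpha\in\mathbb{R}$ and $j\ge 1$ let $\langle\alpha\rangle_j=\alpha(\alpha-1)\cdots(\alpha-j+1)$. For $\alpha\in\mathbb{R}$ and $n\ge1$ put $$c_n(\alpha)=\sum_{j=1}^{n}(-1)^{j}\frac{\langle\alpha\rangle_j}{j!}\sum_{\ell=1}^{j}(-1)^{\ell}(2\ell)!\binom{j}{\ell}\frac{Q(2\ell,2n)}{(2\ell+2n)!}.$$ **Theorem.** Let $\alpha\in\mathbb{R}$. For every real $x$ with $|x|<1$ the series below converges absolutely and $$\biggl[\frac{(\arccos x)^2}{2(1-x)}\biggr]^{\alpha}=1+\sum_{n=1}^{\infty}c_n(\alpha)\,[2(x-1)]^{n}.$$ This is the Taylor expansion of the left-hand side at $x=1^-$: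 for every $n\ge1$, $$\lim_{x\to1^-}\frac{\mathrm{d}^n}{\mathrm{d}x^n}\biggl[\frac{(\arccos x)^2}{2(1-x)}\biggr]^{\alpha}=n!\,2^n c_n(\alpha).$$ -/

import Mathlib

open Filter Topology

noncomputable section

/-- The (signed) Stirling number of the first kind `s(n, k)`, the coefficient of `x ^ k` in
`x (x - 1) ⋯ (x - n + 1)`. Mathlib's `Nat.stirlingFirst n k` is its absolute value; it is `0` for
`k > n`, so the sign `(-1) ^ (n + k)` is the usual `(-1) ^ (n - k)`. -/
def stirlingS (n k : ℕ) : ℝ :=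
  (-1) ^ (n + k) * (Nat.stirlingFirst n k : ℝ)

/-- `Q(k, m) = ∑_{ℓ = 0}^{m} C(k + ℓ - 1, k - 1) s(k + m - 1, k + ℓ - 1) ((k + m - 2) / 2) ^ ℓ`,
for `k ≥ 1` and `m ≥ 2` (it is used only for such arguments, where the subtractions of natural
numbers are genuine). -/
def arcQ (k m : ℕ) : ℝ :=
  ∑ l ∈ Finset.range (m + 1),
    (Nat.choose (k + l - 1) (k - 1) : ℝ) * stirlingS (k + m - 1) (k + l - 1) *
      (((k : ℝ) + (m : ℝ) - 2) / 2) ^ l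

/-- The falling factorial `⟨β⟩_n = β (β - 1) ⋯ (β - n + 1)`. -/
def fallingFactorial (β : ℝ) (n : ℕ) : ℝ :=
  ∏ i ∈ Finset.range n, (β - (i : ℝ))

/-- The coefficient of `[2 (x - 1)] ^ n`, for `n ≥ 1`. -/
def arccosCoeff (α : ℝ) (n : ℕ) : ℝ :=
  ∑ j ∈ Finset.Icc 1 n,
    (-1) ^ j * (fallingFactorial α j / (Nat.factorial j : ℝ)) *
      ∑ l ∈ Finset.Icc 1 j,
        (-1) ^ l * (Nat.factorial (2 * l) : ℝ) * (Nat.choose j l : ℝ) *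
          (arcQ (2 * l) (2 * n) / (Nat.factorial (2 * l + 2 * n) : ℝ))

end

/-! Put `y = 2 (x - 1)` and `h(y) = arccos x / √(2 (1 - x)) = ∫₀¹ (1 + y s² / 4) ^ (-1/2) ds`. The
integral is holomorphic with values in the right half plane for `|y| < 4`, and integrating
`d/ds [s (1 + y s² / 4) ^ (-1/2)]` gives `(y + 4) (h + 2 y h')² = 4`. Hence
`A = y h² = -(arccos x)²` satisfies `y (y + 4) A'² = 4 A` and `y (y + 4) A'' + (y + 2) A' = 2`, and
the operator on the left of the second equation sends `A ^ (l + 1)` to `(2 l + 2) (2 l + 1) A ^ l`.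
On coefficients this is the recurrence of the polynomials `∏_{i < N} (X - i²)`. The numbers
`Q(2 l, 2 n)` are coefficients of the same polynomials: `Q` is a Taylor coefficient of a falling
factorial of odd degree `2 M + 1` at its centre of symmetry `M`, and
`X · (X + M) (X + M - 1) ⋯ (X - M)` is `∏_{i ≤ M} (X² - i²)`.

Finally `g = h ^ (2 α)` is determined by `g' h² = α (h²)' g` and `g(0) = 1`, so it is the binomial
series of exponent `α` in `h² - 1`, whose powers expand into powers of `h²`. -/

section CentralFactorial

open Polynomial

theorem coeff_descPochhammer (R : Type*) [CommRing R] (n k : ℕ) :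
    (descPochhammer R n).coeff k = (-1) ^ (n + k) * (Nat.stirlingFirst n k : R) := by
  induction n generalizing k with
  | zero => cases k <;> simp [coeff_one]
  | succ n ih =>
    rw [descPochhammer_succ_right, mul_sub, coeff_sub, ← C_eq_natCast, coeff_mul_C]
    cases k with
    | zero => cases n <;> simp [ih]
    | succ k =>
      rw [coeff_mul_X, ih, ih, Nat.stirlingFirst_succ_succ]
      push_cast
      ring

/-- The polynomial `∏_{i < N} (X - i²)`, whose coefficients are the central factorial numbers of
even index. -/
noncomputable def centralFactorial (N : ℕ) : ℤ[X] :=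
  ∏ i ∈ Finset.range N, (X - C ((i : ℤ) ^ 2))

theorem centralFactorial_succ (N : ℕ) :
    centralFactorial (N + 1) = centralFactorial N * (X - C ((N : ℤ) ^ 2)) :=
  Finset.prod_range_succ _ N

theorem coeff_zero_centralFactorial_succ (N : ℕ) : (centralFactorial (N + 1)).coeff 0 = 0 := by
  simp [centralFactorial, Finset.prod_range_succ']

theorem coeff_succ_centralFactorial_succ (N l : ℕ) :
    (centralFactorial (N + 1)).coeff (l + 1) =
      (centralFactorial N).coeff l - (N : ℤ) ^ 2 * (centralFactorial N).coeff (l + 1) := by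
  rw [centralFactorial_succ, mul_sub, coeff_sub, coeff_mul_X, coeff_mul_C, mul_comm]

theorem X_mul_descPochhammer_comp_X_add (M : ℕ) :
    X * (descPochhammer ℤ (2 * M + 1)).comp (X + C (M : ℤ)) =
      expand ℤ 2 (centralFactorial (M + 1)) := by
  induction M with
  | zero => simp [centralFactorial, sq]
  | succ M ih =>
    have hshift : (X - 1 : ℤ[X]).comp (X + C ((M + 1 : ℕ) : ℤ)) = X + C (M : ℤ) := by
      simp only [sub_comp, X_comp, one_comp, map_natCast, Nat.cast_succ, map_add, map_one]
      ring
    rw [centralFactorial_succ, map_mul, ← ih, show 2 * (M + 1) + 1 = (2 * M + 1 + 1) + 1 by ring,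
      descPochhammer_succ_left, descPochhammer_succ_right]
    simp only [mul_comp, comp_assoc, hshift, X_comp, sub_comp, natCast_comp, map_sub, expand_X,
      expand_C]
    push_cast
    simp only [map_add, map_one, map_pow, map_natCast]
    ring

theorem coeff_descPochhammer_comp_X_add (n k M : ℕ) {m : ℕ} (hm : n ≤ k + m) :
    ((descPochhammer ℤ n).comp (X + C (M : ℤ))).coeff k =
      ∑ i ∈ Finset.range (m + 1),
        ((i + k).choose k : ℤ) * ((-1) ^ (n + (i + k)) * Nat.stirlingFirst n (i + k)) * M ^ i := by
  have hdeg : (hasseDeriv k (descPochhammer ℤ n)).natDegree < m + 1 := by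
    have := natDegree_hasseDeriv_le (descPochhammer ℤ n) k
    rw [descPochhammer_natDegree] at this
    omega
  rw [← taylor_apply, taylor_coeff, eval_eq_sum_range' hdeg]
  simp only [hasseDeriv_coeff, coeff_descPochhammer]

theorem arcQ_two_mul_two_mul {l n : ℕ} (hl : 1 ≤ l) (hn : 1 ≤ n) :
    arcQ (2 * l) (2 * n) = (centralFactorial (l + n)).coeff l := by
  obtain ⟨M, hM⟩ : ∃ M, l + n = M + 1 := ⟨l + n - 1, by omega⟩
  have hcoeff : (centralFactorial (l + n)).coeff l =
      ((descPochhammer ℤ (2 * M + 1)).comp (X + C (M : ℤ))).coeff (2 * l - 1) := by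
    rw [← coeff_X_mul (p := (descPochhammer ℤ (2 * M + 1)).comp (X + C (M : ℤ))),
      X_mul_descPochhammer_comp_X_add, ← hM,
      show 2 * l - 1 + 1 = l * 2 by omega, coeff_expand_mul two_pos]
  have hhalf : ((2 * l : ℕ) + (2 * n : ℕ) - 2 : ℝ) / 2 = M := by
    have : (l : ℝ) + n = M + 1 := by exact_mod_cast hM
    push_cast
    linarith
  rw [hcoeff, coeff_descPochhammer_comp_X_add _ _ _ (m := 2 * n) (by omega), arcQ, hhalf,
    show 2 * l + 2 * n - 1 = 2 * M + 1 by omega]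
  push_cast
  refine Finset.sum_congr rfl fun i _ => ?_
  rw [stirlingS, show 2 * l + i - 1 = i + (2 * l - 1) by omega]

end CentralFactorial

section PowerSeries

open PowerSeries

variable {R : Type*} [CommRing R]

theorem coeff_X_mul_derivative (f : R⟦X⟧) (n : ℕ) :
    coeff n (X * d⁄dX R f) = n * coeff n f := by
  cases n with
  | zero => simp
  | succ n => rw [coeff_succ_X_mul, coeff_derivative, Nat.cast_succ, mul_comm]

theorem coeff_arccosSq_operator (f : R⟦X⟧) (n : ℕ) :
    coeff n (X * (X + 4) * d⁄dX R (d⁄dX R f) + (X + 2) * d⁄dX R f) =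
      (2 * n + 2) * (2 * n + 1) * coeff (n + 1) f + n ^ 2 * coeff n f := by
  have euler : X * (X + 4) * d⁄dX R (d⁄dX R f) + (X + 2) * d⁄dX R f =
      C 4 * d⁄dX R (X * d⁄dX R f) - C 2 * d⁄dX R f + X * d⁄dX R (X * d⁄dX R f) := by
    simp only [Derivation.leibniz, derivative_X, smul_eq_mul, map_ofNat]
    ring
  rw [euler, map_add, map_sub, coeff_C_mul, coeff_C_mul, coeff_X_mul_derivative,
    coeff_X_mul_derivative, coeff_derivative, coeff_derivative, coeff_X_mul_derivative]
  push_cast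
  ring

theorem arccosSq_operator_pow_succ {A : R⟦X⟧} (hA : X * (X + 4) * d⁄dX R A ^ 2 = 4 * A)
    (hA' : X * (X + 4) * d⁄dX R (d⁄dX R A) + (X + 2) * d⁄dX R A = 2) (l : ℕ) :
    X * (X + 4) * d⁄dX R (d⁄dX R (A ^ (l + 1))) + (X + 2) * d⁄dX R (A ^ (l + 1)) =
      C ((2 * l + 2) * (2 * l + 1) : R) * A ^ l := by
  simp only [map_mul, map_add, map_natCast, map_ofNat, map_one]
  cases l with
  | zero =>
    simp only [zero_add, pow_one, pow_zero]
    push_cast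
    linear_combination hA'
  | succ l =>
    simp only [Derivation.leibniz, derivative_pow, smul_eq_mul, Derivation.map_natCast,
      Nat.add_sub_cancel]
    push_cast
    linear_combination (((l : R⟦X⟧) + 2) * (l + 1) * A ^ l) * hA +
      (((l : R⟦X⟧) + 2) * A ^ (l + 1)) * hA'

theorem factorial_two_mul_succ (n : ℕ) :
    (2 * (n + 1)).factorial = (2 * n + 2) * (2 * n + 1) * (2 * n).factorial := by
  rw [show 2 * (n + 1) = 2 * n + 1 + 1 by ring, Nat.factorial_succ, Nat.factorial_succ]
  ring

theorem factorial_mul_coeff_pow_eq_centralFactorial {A : R⟦X⟧} (h0 : constantCoeff A = 0)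
    (hA : X * (X + 4) * d⁄dX R A ^ 2 = 4 * A)
    (hA' : X * (X + 4) * d⁄dX R (d⁄dX R A) + (X + 2) * d⁄dX R A = 2) (N l : ℕ) :
    ((2 * N).factorial : R) * coeff N (A ^ l) =
      (2 * l).factorial * (centralFactorial N).coeff l := by
  induction N generalizing l with
  | zero => cases l <;> simp [centralFactorial, Polynomial.coeff_one, h0]
  | succ N ih =>
    cases l with
    | zero => simp [coeff_zero_centralFactorial_succ, coeff_one]
    | succ l =>
      have recurrence := congrArg (coeff N) (arccosSq_operator_pow_succ hA hA' l)
      rw [coeff_arccosSq_operator, coeff_C_mul] at recurrence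
      have ih_succ := ih (l + 1)
      rw [factorial_two_mul_succ] at ih_succ
      rw [coeff_succ_centralFactorial_succ, factorial_two_mul_succ, factorial_two_mul_succ]
      push_cast at ih_succ ⊢
      linear_combination ((2 * N).factorial : R) * recurrence +
        (2 * l + 2) * (2 * l + 1) * ih l - (N : R) ^ 2 * ih_succ

theorem derivative_X_mul_sq (h : R⟦X⟧) :
    d⁄dX R (X * h ^ 2) = h * (h + 2 * (X * d⁄dX R h)) := by
  simp only [Derivation.leibniz, derivative_pow, derivative_X, smul_eq_mul]
  push_cast
  ring

theorem X_mul_derivative_X_mul_sq_sq {h : R⟦X⟧}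
    (hh : (X + 4) * (h + 2 * (X * d⁄dX R h)) ^ 2 = 4) :
    X * (X + 4) * d⁄dX R (X * h ^ 2) ^ 2 = 4 * (X * h ^ 2) := by
  rw [derivative_X_mul_sq]
  linear_combination (X * h ^ 2) * hh

variable [IsDomain R] [CharZero R]

theorem arccosSq_operator_eq_two {h : R⟦X⟧}
    (hh : (X + 4) * (h + 2 * (X * d⁄dX R h)) ^ 2 = 4) :
    X * (X + 4) * d⁄dX R (d⁄dX R (X * h ^ 2)) + (X + 2) * d⁄dX R (X * h ^ 2) = 2 := by
  have series_two_ne_zero : (2 : R⟦X⟧) ≠ 0 := by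
    rw [← map_ofNat (C (R := R)), map_ne_zero_iff _ C_injective]
    exact two_ne_zero
  obtain ⟨w, hw⟩ : ∃ w, w = h + 2 * (X * d⁄dX R h) := ⟨_, rfl⟩
  rw [← hw] at hh
  have w_ne_zero : w ≠ 0 := by
    rintro rfl
    exact mul_ne_zero series_two_ne_zero series_two_ne_zero (by linear_combination -hh)
  have derivative_w : 2 * (X + 4) * d⁄dX R w = -w := by
    have := congrArg (d⁄dX R) hh
    have derivative_four : d⁄dX R (4 : R⟦X⟧) = 0 := (d⁄dX R).map_natCast 4
    simp only [Derivation.leibniz, derivative_pow, map_add, derivative_X, derivative_four,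
      smul_eq_mul] at this
    refine mul_left_cancel₀ w_ne_zero ?_
    push_cast at this
    linear_combination this
  have derivative_h : 2 * (X * d⁄dX R h) = w - h := by rw [hw]; ring
  refine mul_left_cancel₀ series_two_ne_zero ?_
  rw [derivative_X_mul_sq, ← hw, Derivation.leibniz, smul_eq_mul, smul_eq_mul]
  linear_combination hh + X * h * derivative_w + (X + 4) * w * derivative_h

theorem factorial_mul_coeff_sq_pow_eq_centralFactorial {h : R⟦X⟧}
    (hh : (X + 4) * (h + 2 * (X * d⁄dX R h)) ^ 2 = 4) (l n : ℕ) :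
    ((2 * (l + n)).factorial : R) * coeff n ((h ^ 2) ^ l) =
      (2 * l).factorial * (centralFactorial (l + n)).coeff l := by
  rw [← factorial_mul_coeff_pow_eq_centralFactorial (A := X * h ^ 2) (by simp)
    (X_mul_derivative_X_mul_sq_sq hh) (arccosSq_operator_eq_two hh), mul_pow, add_comm l n,
    coeff_X_pow_mul]

end PowerSeries

section Binomial

open PowerSeries

theorem coeff_subst_eq_sum_range {R : Type*} [CommRing R] {f : R⟦X⟧} (hf : constantCoeff f = 0)
    (p : R⟦X⟧) (n : ℕ) :
    coeff n (p.subst f) = ∑ j ∈ Finset.range (n + 1), coeff j p * coeff n (f ^ j) := by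
  rw [coeff_subst' (HasSubst.of_constantCoeff_zero' hf)]
  refine finsum_eq_sum_of_support_subset _ fun j hj => ?_
  by_contra hjn
  rw [Finset.mem_coe, Finset.mem_range] at hjn
  have X_pow_dvd : X ^ j ∣ f ^ j := pow_dvd_pow_of_dvd (X_dvd_iff.2 hf) j
  exact hj (by simp only [X_pow_dvd_iff.1 X_pow_dvd n (by omega), smul_zero])

theorem coeff_sub_one_pow {R : Type*} [CommRing R] (f : R⟦X⟧) (j : ℕ) {n : ℕ} (hn : n ≠ 0) :
    coeff n ((f - 1) ^ j) =
      ∑ l ∈ Finset.Icc 1 j, (-1) ^ (l + j) * j.choose l * coeff n (f ^ l) := by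
  have coeff_summand (l : ℕ) :
      coeff n ((-1) ^ (l + j) * f ^ l * 1 ^ (j - l) * (j.choose l : R⟦X⟧)) =
        (-1) ^ (l + j) * j.choose l * coeff n (f ^ l) := by
    rw [← coeff_C_mul]
    simp only [map_mul, map_pow, map_neg, map_one, map_natCast, one_pow]
    ring_nf
  rw [sub_pow, map_sum, Finset.sum_congr rfl fun l _ => coeff_summand l,
    Finset.sum_range_eq_add_Ico _ j.succ_pos, pow_zero, coeff_one, if_neg hn, mul_zero, zero_add]
  rfl

variable {K : Type*} [Field K] [CharZero K]

theorem one_add_X_mul_derivative_binomialSeries (a : K) :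
    (1 + X) * d⁄dX K (binomialSeries K a) = C a * binomialSeries K a := by
  have choose_succ (n : ℕ) : (n + 1 : K) * Ring.choose a (n + 1) = (a - n) * Ring.choose a n := by
    have := Ring.choose_smul_choose a (Nat.le_succ n)
    simp only [Nat.succ_eq_add_one, Nat.choose_succ_self_right, nsmul_eq_mul, Nat.cast_succ,
      add_tsub_cancel_left, Ring.choose_one_right', pow_one] at this
    linear_combination this
  ext n
  rw [add_mul, one_mul, map_add, coeff_X_mul_derivative, coeff_derivative, coeff_C_mul]
  simp only [binomialSeries_coeff, smul_eq_mul, mul_one]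
  linear_combination choose_succ n

theorem eq_of_derivative_mul_eq {f g : K⟦X⟧} (hf : constantCoeff f ≠ 0)
    (h0 : constantCoeff g = constantCoeff f) (h : d⁄dX K g * f = d⁄dX K f * g) : g = f := by
  have f_mul_inv : f * f⁻¹ = 1 := PowerSeries.mul_inv_cancel f hf
  have quotient_eq_one : g * f⁻¹ = 1 := by
    refine derivative.ext ?_ (by simp [h0, hf])
    rw [Derivation.leibniz, derivative_inv', Derivation.map_one_eq_zero, smul_eq_mul, smul_eq_mul]
    linear_combination (f⁻¹ ^ 2) * h - (d⁄dX K g * f⁻¹) * f_mul_inv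
  calc g = g * f⁻¹ * f := by rw [mul_assoc, mul_comm f⁻¹, f_mul_inv, mul_one]
    _ = f := by rw [quotient_eq_one, one_mul]

theorem eq_binomialSeries_subst {a : K} {f g : K⟦X⟧} (hf : constantCoeff f = 1)
    (hg : constantCoeff g = 1) (h : d⁄dX K g * f = C a * d⁄dX K f * g) :
    g = (binomialSeries K a).subst (f - 1) := by
  have hf0 : constantCoeff (f - 1) = 0 := by simp [hf]
  have hs : HasSubst (f - 1) := HasSubst.of_constantCoeff_zero' hf0
  set p := (binomialSeries K a).subst (f - 1) with hp
  have p_ode : f * d⁄dX K p = C a * d⁄dX K f * p := by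
    have := congrArg (fun q : K⟦X⟧ => q.subst (f - 1) * d⁄dX K (f - 1))
      (one_add_X_mul_derivative_binomialSeries a)
    have one_subst : (1 : K⟦X⟧).subst (f - 1) = 1 := by rw [← coe_substAlgHom hs, map_one]
    have C_subst : (C a).subst (f - 1) = C a := subst_C a
    simp only [subst_mul hs, subst_add hs, subst_X hs, one_subst, C_subst, add_sub_cancel,
      mul_assoc, ← derivative_subst hs, ← hp] at this
    rw [this, map_sub, Derivation.map_one_eq_zero, sub_zero]
    ring
  have hp0 : constantCoeff p = 1 := by
    rw [← coeff_zero_eq_constantCoeff_apply, hp, coeff_subst_eq_sum_range hf0]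
    simp
  have f_ne_zero : f ≠ 0 := by rintro rfl; simp at hf
  refine eq_of_derivative_mul_eq (by simp [hp0]) (by rw [hg, hp0]) (mul_left_cancel₀ f_ne_zero ?_)
  linear_combination p * h - g * p_ode

end Binomial

section ArccosCoeff

open PowerSeries

/-- The coefficient of `[2 (x - 1)] ^ n` for every `n`: the constant term is `1`, whereas
`arccosCoeff α 0` is an empty sum. -/
noncomputable def arccosTaylorCoeff (α : ℝ) (n : ℕ) : ℝ :=
  if n = 0 then 1 else arccosCoeff α n

theorem fallingFactorial_div_factorial (β : ℝ) (n : ℕ) :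
    fallingFactorial β n / n.factorial = Ring.choose β n := by
  rw [Ring.choose_eq_smul, Polynomial.descPochhammer_smeval_eq_ascPochhammer,
    Polynomial.ascPochhammer_smeval_eq_eval, ← descPochhammer_eval_eq_ascPochhammer,
    descPochhammer_eval_eq_prod_range, smul_eq_mul, fallingFactorial, div_eq_inv_mul]

theorem coeff_sq_pow_eq_arcQ {h : ℂ⟦X⟧} (hh : (X + 4) * (h + 2 * (X * d⁄dX ℂ h)) ^ 2 = 4)
    {l n : ℕ} (hl : 1 ≤ l) (hn : 1 ≤ n) :
    coeff n ((h ^ 2) ^ l) =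
      (((2 * l).factorial * (arcQ (2 * l) (2 * n) / (2 * l + 2 * n).factorial) : ℝ) : ℂ) := by
  have key := factorial_mul_coeff_sq_pow_eq_centralFactorial hh l n
  have factorial_ne_zero : ((2 * l + 2 * n).factorial : ℂ) ≠ 0 :=
    Nat.cast_ne_zero.2 (Nat.factorial_ne_zero _)
  rw [mul_add] at key
  rw [arcQ_two_mul_two_mul hl hn]
  push_cast
  field_simp
  linear_combination key

theorem coeff_eq_arccosTaylorCoeff (α : ℝ) {g h : ℂ⟦X⟧}
    (hh : (X + 4) * (h + 2 * (X * d⁄dX ℂ h)) ^ 2 = 4) (h0 : constantCoeff h = 1)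
    (g0 : constantCoeff g = 1) (hg : d⁄dX ℂ g * h ^ 2 = C (α : ℂ) * d⁄dX ℂ (h ^ 2) * g) (n : ℕ) :
    coeff n g = arccosTaylorCoeff α n := by
  rcases eq_or_ne n 0 with rfl | hn
  · simp [arccosTaylorCoeff, g0]
  have hsq : constantCoeff (h ^ 2) = 1 := by simp [h0]
  rw [eq_binomialSeries_subst hsq g0 hg, coeff_subst_eq_sum_range (by simp [hsq]),
    Finset.sum_range_eq_add_Ico _ n.succ_pos, pow_zero, coeff_one, if_neg hn, mul_zero, zero_add,
    arccosTaylorCoeff, if_neg hn, arccosCoeff, Complex.ofReal_sum]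
  refine Finset.sum_congr rfl fun j _ => ?_
  rw [binomialSeries_coeff, coeff_sub_one_pow _ _ hn, fallingFactorial_div_factorial,
    Finset.mul_sum, Finset.mul_sum, Complex.ofReal_sum]
  refine Finset.sum_congr rfl fun l hl => ?_
  rw [coeff_sq_pow_eq_arcQ hh (Finset.mem_Icc.1 hl).1 (Nat.one_le_iff_ne_zero.2 hn)]
  push_cast
  rw [smul_eq_mul]
  ring

end ArccosCoeff

section TaylorPowerSeries

variable {𝕜 : Type*} [NontriviallyNormedField 𝕜]

/-- The formal power series of Taylor coefficients of `f` at `0`. -/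
noncomputable def taylorPowerSeries (f : 𝕜 → 𝕜) : PowerSeries 𝕜 :=
  PowerSeries.mk fun n => (n.factorial : 𝕜)⁻¹ * iteratedDeriv n f 0

namespace taylorPowerSeries

theorem coeff (f : 𝕜 → 𝕜) (n : ℕ) :
    (taylorPowerSeries f).coeff n = (n.factorial : 𝕜)⁻¹ * iteratedDeriv n f 0 :=
  PowerSeries.coeff_mk _ _

theorem constantCoeff (f : 𝕜 → 𝕜) : (taylorPowerSeries f).constantCoeff = f 0 := by
  rw [← PowerSeries.coeff_zero_eq_constantCoeff_apply, coeff]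
  simp

theorem congr {f g : 𝕜 → 𝕜} (h : f =ᶠ[𝓝 0] g) : taylorPowerSeries f = taylorPowerSeries g := by
  ext n
  rw [coeff, coeff, h.iteratedDeriv_eq]

theorem const (c : 𝕜) : taylorPowerSeries (fun _ => c) = PowerSeries.C c := by
  ext n
  rw [coeff, iteratedDeriv_const, PowerSeries.coeff_C]
  split_ifs with h <;> simp [h]

theorem add [CompleteSpace 𝕜] {f g : 𝕜 → 𝕜} (hf : AnalyticAt 𝕜 f 0) (hg : AnalyticAt 𝕜 g 0) :
    taylorPowerSeries (fun z => f z + g z) = taylorPowerSeries f + taylorPowerSeries g := by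
  ext n
  rw [map_add, coeff, coeff, coeff, iteratedDeriv_fun_add hf.contDiffAt hg.contDiffAt, mul_add]

variable [CharZero 𝕜]

theorem derivative (f : 𝕜 → 𝕜) :
    taylorPowerSeries (fun z => deriv f z) = PowerSeries.derivative 𝕜 (taylorPowerSeries f) := by
  ext n
  rw [PowerSeries.coeff_derivative, coeff, coeff, ← iteratedDeriv_succ', Nat.factorial_succ]
  have : (n + 1 : 𝕜) ≠ 0 := by exact_mod_cast n.succ_ne_zero
  push_cast
  field_simp

theorem id : taylorPowerSeries (fun z : 𝕜 => z) = PowerSeries.X := by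
  refine PowerSeries.derivative.ext ?_ (by simp [constantCoeff])
  simp only [← derivative, deriv_id'', const, map_one, PowerSeries.derivative_X]

variable [CompleteSpace 𝕜] {f g : 𝕜 → 𝕜}

theorem mul (hf : AnalyticAt 𝕜 f 0) (hg : AnalyticAt 𝕜 g 0) :
    taylorPowerSeries (fun z => f z * g z) = taylorPowerSeries f * taylorPowerSeries g := by
  ext n
  rw [PowerSeries.coeff_mul, coeff, iteratedDeriv_fun_mul hf.contDiffAt hg.contDiffAt,
    Finset.mul_sum, Finset.Nat.sum_antidiagonal_eq_sum_range_succ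
      (fun i j => (taylorPowerSeries f).coeff i * (taylorPowerSeries g).coeff j)]
  refine Finset.sum_congr rfl fun i hi => ?_
  rw [coeff, coeff, Nat.cast_choose 𝕜 (Nat.lt_succ_iff.1 (Finset.mem_range.1 hi))]
  have factorial_ne_zero : (n.factorial : 𝕜) ≠ 0 := Nat.cast_ne_zero.2 n.factorial_ne_zero
  field_simp

theorem sq (hf : AnalyticAt 𝕜 f 0) :
    taylorPowerSeries (fun z => f z ^ 2) = taylorPowerSeries f ^ 2 := by
  simp only [_root_.sq, mul hf hf]

end taylorPowerSeries

end TaylorPowerSeries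

section ArccosQuot

open Complex MeasureTheory

theorem one_add_mul_sq_div_four_mem_slitPlane {y : ℂ} (hy : y ∈ Metric.ball (0 : ℂ) 4) {s : ℝ}
    (hs : s ∈ Set.Icc (0 : ℝ) 1) : 1 + y * (s : ℂ) ^ 2 / 4 ∈ slitPlane := by
  refine mem_slitPlane_of_norm_lt_one ?_
  have sq_le_one : s ^ 2 ≤ 1 := pow_le_one₀ hs.1 hs.2
  rw [mem_ball_zero_iff] at hy
  rw [norm_div, norm_mul, norm_pow, norm_real, Real.norm_of_nonneg hs.1,
    RCLike.norm_ofNat]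
  linarith [mul_le_of_le_one_right (norm_nonneg y) sq_le_one]

/-- The holomorphic function on the disc of radius `4` which takes the value
`arccos x / √(2 (1 - x))` at `y = 2 (x - 1)`, as an integral. -/
noncomputable def arccosQuot (y : ℂ) : ℂ :=
  ∫ s in (0 : ℝ)..1, (1 + y * (s : ℂ) ^ 2 / 4) ^ (-(1 / 2) : ℂ)

theorem continuousOn_one_add_mul_sq_div_four_cpow (a : ℂ) :
    ContinuousOn (fun p : ℂ × ℝ => (1 + p.1 * (p.2 : ℂ) ^ 2 / 4) ^ a)
      (Metric.ball 0 4 ×ˢ Set.Icc (0 : ℝ) 1) :=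
  ContinuousOn.cpow_const (by fun_prop) fun _ hp =>
    one_add_mul_sq_div_four_mem_slitPlane hp.1 hp.2

theorem intervalIntegrable_mul_one_add_mul_sq_div_four_cpow {f : ℝ → ℂ} (hf : Continuous f) (a : ℂ)
    {y : ℂ} (hy : y ∈ Metric.ball (0 : ℂ) 4) :
    IntervalIntegrable (fun s : ℝ => f s * (1 + y * (s : ℂ) ^ 2 / 4) ^ a) volume 0 1 := by
  refine ContinuousOn.intervalIntegrable ?_
  rw [Set.uIcc_of_le zero_le_one]
  have power_continuousOn : ContinuousOn (fun s : ℝ => (1 + y * (s : ℂ) ^ 2 / 4) ^ a)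
      (Set.Icc 0 1) :=
    (continuousOn_one_add_mul_sq_div_four_cpow a).comp (f := fun s => (y, s)) (by fun_prop)
      fun _ hs => ⟨hy, hs⟩
  exact hf.continuousOn.mul power_continuousOn

theorem intervalIntegrable_one_add_mul_sq_div_four_cpow (a : ℂ) {y : ℂ}
    (hy : y ∈ Metric.ball (0 : ℂ) 4) :
    IntervalIntegrable (fun s : ℝ => (1 + y * (s : ℂ) ^ 2 / 4) ^ a) volume 0 1 := by
  simpa only [one_mul] using
    intervalIntegrable_mul_one_add_mul_sq_div_four_cpow continuous_const (f := fun _ => 1) a hy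

theorem hasDerivAt_one_add_mul_sq_div_four_cpow {y : ℂ} (hy : y ∈ Metric.ball (0 : ℂ) 4) {s : ℝ}
    (hs : s ∈ Set.Icc (0 : ℝ) 1) :
    HasDerivAt (fun w : ℂ => (1 + w * (s : ℂ) ^ 2 / 4) ^ (-(1 / 2) : ℂ))
      (-(1 / 8) * (s : ℂ) ^ 2 * (1 + y * (s : ℂ) ^ 2 / 4) ^ (-(3 / 2) : ℂ)) y := by
  have base_hasDerivAt : HasDerivAt (fun w : ℂ => 1 + w * (s : ℂ) ^ 2 / 4)
      (1 * (s : ℂ) ^ 2 / 4) y :=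
    (((hasDerivAt_id y).mul_const _).div_const 4).const_add 1
  refine (base_hasDerivAt.cpow_const (c := (-(1 / 2) : ℂ))
    (one_add_mul_sq_div_four_mem_slitPlane hy hs)).congr_deriv ?_
  rw [show (-(1 / 2) - 1 : ℂ) = -(3 / 2) by norm_num]
  ring

theorem hasDerivAt_arccosQuot {y : ℂ} (hy : y ∈ Metric.ball (0 : ℂ) 4) :
    HasDerivAt arccosQuot (∫ s in (0 : ℝ)..1,
      -(1 / 8) * (s : ℂ) ^ 2 * (1 + y * (s : ℂ) ^ 2 / 4) ^ (-(3 / 2) : ℂ)) y := by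
  obtain ⟨r, hyr, hr⟩ := exists_between (mem_ball_zero_iff.1 hy)
  have closedBall_subset : Metric.closedBall (0 : ℂ) r ⊆ Metric.ball 0 4 :=
    Metric.closedBall_subset_ball hr
  have ball_mem_nhds : Metric.ball (0 : ℂ) r ∈ 𝓝 y :=
    Metric.isOpen_ball.mem_nhds (mem_ball_zero_iff.2 hyr)
  have mem_Icc {s : ℝ} (hs : s ∈ Set.uIoc (0 : ℝ) 1) : s ∈ Set.Icc (0 : ℝ) 1 :=
    Set.Ioc_subset_Icc_self (Set.uIoc_of_le zero_le_one (α := ℝ) ▸ hs)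
  have derivative_continuousOn : ContinuousOn (fun p : ℂ × ℝ => -(1 / 8) * (p.2 : ℂ) ^ 2 *
      (1 + p.1 * (p.2 : ℂ) ^ 2 / 4) ^ (-(3 / 2) : ℂ))
      (Metric.closedBall 0 r ×ˢ Set.Icc (0 : ℝ) 1) :=
    ContinuousOn.mul (by fun_prop) ((continuousOn_one_add_mul_sq_div_four_cpow _).mono
      (Set.prod_mono closedBall_subset subset_rfl))
  obtain ⟨B, hB⟩ := ((isCompact_closedBall (0 : ℂ) r).prod
    (isCompact_Icc (a := (0 : ℝ)) (b := 1))).exists_bound_of_continuousOn derivative_continuousOn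
  refine (intervalIntegral.hasDerivAt_integral_of_dominated_loc_of_deriv_le
    (F := fun (y : ℂ) (s : ℝ) => (1 + y * (s : ℂ) ^ 2 / 4) ^ (-(1 / 2) : ℂ))
    (F' := fun (y : ℂ) (s : ℝ) => -(1 / 8) * (s : ℂ) ^ 2 *
      (1 + y * (s : ℂ) ^ 2 / 4) ^ (-(3 / 2) : ℂ))
    (bound := fun _ => B) ball_mem_nhds ?_ (intervalIntegrable_one_add_mul_sq_div_four_cpow _ hy)
    (intervalIntegrable_mul_one_add_mul_sq_div_four_cpow (by fun_prop) _
      hy).def'.aestronglyMeasurable ?_ (by simp) ?_).2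
  · filter_upwards [ball_mem_nhds] with w hw
    exact (intervalIntegrable_one_add_mul_sq_div_four_cpow _
      (Metric.ball_subset_ball hr.le hw)).def'.aestronglyMeasurable
  · exact Eventually.of_forall fun s hs w hw =>
      hB (w, s) ⟨Metric.ball_subset_closedBall hw, mem_Icc hs⟩
  · exact Eventually.of_forall fun s hs w hw =>
      hasDerivAt_one_add_mul_sq_div_four_cpow (Metric.ball_subset_ball hr.le hw) (mem_Icc hs)

theorem differentiableOn_arccosQuot : DifferentiableOn ℂ arccosQuot (Metric.ball 0 4) :=
  fun _ hy => (hasDerivAt_arccosQuot hy).differentiableAt.differentiableWithinAt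

theorem arccosQuot_zero : arccosQuot 0 = 1 := by simp [arccosQuot]

theorem arccosQuot_add_two_mul_deriv {y : ℂ} (hy : y ∈ Metric.ball (0 : ℂ) 4) :
    arccosQuot y + 2 * (y * deriv arccosQuot y) = (1 + y / 4) ^ (-(1 / 2) : ℂ) := by
  have integrable := intervalIntegrable_one_add_mul_sq_div_four_cpow (-(1 / 2)) hy
  have integrable_deriv := (intervalIntegrable_mul_one_add_mul_sq_div_four_cpow
    (f := fun s : ℝ => -(1 / 8) * (s : ℂ) ^ 2) (by fun_prop) (-(3 / 2)) hy).const_mul (2 * y)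
  have primitive_hasDerivAt : ∀ s ∈ Set.uIcc (0 : ℝ) 1,
      HasDerivAt (fun s : ℝ => (s : ℂ) * (1 + y * (s : ℂ) ^ 2 / 4) ^ (-(1 / 2) : ℂ))
        ((1 + y * (s : ℂ) ^ 2 / 4) ^ (-(1 / 2) : ℂ) + 2 * y * (-(1 / 8) * (s : ℂ) ^ 2 *
          (1 + y * (s : ℂ) ^ 2 / 4) ^ (-(3 / 2) : ℂ))) s := by
    intro s hs
    rw [Set.uIcc_of_le zero_le_one] at hs
    have base_hasDerivAt :
        HasDerivAt (fun w : ℂ => 1 + y * w ^ 2 / 4) (y * (2 * (s : ℂ)) / 4) s := by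
      simpa using (((hasDerivAt_pow 2 (s : ℂ)).const_mul y).div_const 4).const_add 1
    refine ((hasDerivAt_id (s : ℂ)).mul (base_hasDerivAt.cpow_const (c := (-(1 / 2) : ℂ))
      (one_add_mul_sq_div_four_mem_slitPlane hy hs))).comp_ofReal.congr_deriv ?_
    rw [show (-(1 / 2) - 1 : ℂ) = -(3 / 2) by norm_num]
    simp only [id]
    ring
  rw [(hasDerivAt_arccosQuot hy).deriv, arccosQuot, ← mul_assoc,
    ← intervalIntegral.integral_const_mul,
    ← intervalIntegral.integral_add integrable integrable_deriv,
    intervalIntegral.integral_eq_sub_of_hasDerivAt primitive_hasDerivAt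
      (integrable.add integrable_deriv)]
  simp

theorem arccosQuot_ode {y : ℂ} (hy : y ∈ Metric.ball (0 : ℂ) 4) :
    (y + 4) * (arccosQuot y + 2 * (y * deriv arccosQuot y)) ^ 2 = 4 := by
  have base_ne_zero : 1 + y / 4 ≠ 0 := by
    simpa using slitPlane_ne_zero
      (one_add_mul_sq_div_four_mem_slitPlane hy (Set.right_mem_Icc.2 zero_le_one))
  rw [arccosQuot_add_two_mul_deriv hy, ← cpow_mul_nat, Nat.cast_ofNat,
    show (-(1 / 2) * 2 : ℂ) = -1 by norm_num, cpow_neg_one, show y + 4 = 4 * (1 + y / 4) by ring,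
    mul_assoc, mul_inv_cancel₀ base_ne_zero, mul_one]

theorem re_cpow_neg_half_pos {w : ℂ} (hw : w ∈ slitPlane) : 0 < (w ^ (-(1 / 2) : ℂ)).re := by
  have exponent_im : (log w * (-(1 / 2) : ℂ)).im = -(arg w / 2) := by
    rw [show (-(1 / 2) : ℂ) = ((-(1 / 2) : ℝ) : ℂ) by push_cast; rfl, im_mul_ofReal, log_im]
    ring
  have arg_lt_pi := (arg_le_pi w).lt_of_ne (mem_slitPlane_iff_arg.1 hw).1
  rw [cpow_def_of_ne_zero (slitPlane_ne_zero hw), exp_re, exponent_im]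
  refine mul_pos (Real.exp_pos _) (Real.cos_pos_of_mem_Ioo ⟨?_, ?_⟩)
  · linarith
  · linarith [neg_pi_lt_arg w]

theorem arccosQuot_mem_slitPlane {y : ℂ} (hy : y ∈ Metric.ball (0 : ℂ) 4) :
    arccosQuot y ∈ slitPlane := by
  have integrable := intervalIntegrable_one_add_mul_sq_div_four_cpow (-(1 / 2)) hy
  have re_eq : (arccosQuot y).re =
      ∫ s in (0 : ℝ)..1, ((1 + y * (s : ℂ) ^ 2 / 4) ^ (-(1 / 2) : ℂ)).re :=
    (reCLM.intervalIntegral_comp_comm integrable).symm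
  refine Or.inl ?_
  rw [re_eq]
  refine intervalIntegral.intervalIntegral_pos_of_pos_on ⟨integrable.1.re, integrable.2.re⟩
    (fun s hs => ?_) zero_lt_one
  exact re_cpow_neg_half_pos
    (one_add_mul_sq_div_four_mem_slitPlane hy (Set.Ioo_subset_Icc_self hs))

theorem two_mul_sub_one_mem_ball {x : ℝ} (hx : |x| < 1) :
    ((2 * (x - 1) : ℝ) : ℂ) ∈ Metric.ball (0 : ℂ) 4 := by
  rw [mem_ball_zero_iff, norm_real, Real.norm_eq_abs, abs_lt]
  constructor <;> linarith [(abs_lt.1 hx).1, (abs_lt.1 hx).2]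

theorem hasDerivAt_arccos_one_sub_mul_sq {u s : ℝ} (hu : 0 < u) (hs : 0 < s)
    (hus : u * s ^ 2 < 2) :
    HasDerivAt (fun s => Real.arccos (1 - u * s ^ 2) / √(2 * u)) (√(1 - u * s ^ 2 / 2))⁻¹ s := by
  have us_pos : 0 < u * s ^ 2 := by positivity
  have two_u_ne_zero : √(2 * u) ≠ 0 := (Real.sqrt_pos.2 (by positivity)).ne'
  have inner_hasDerivAt : HasDerivAt (fun s : ℝ => 1 - u * s ^ 2) (-(u * (2 * s))) s := by
    simpa using ((hasDerivAt_pow 2 s).const_mul u).const_sub 1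
  have sqrt_eq : √(1 - (1 - u * s ^ 2) ^ 2) = √(2 * u) * s * √(1 - u * s ^ 2 / 2) := by
    rw [show 1 - (1 - u * s ^ 2) ^ 2 = 2 * u * s ^ 2 * (1 - u * s ^ 2 / 2) by ring,
      Real.sqrt_mul (by positivity), Real.sqrt_mul (by positivity), Real.sqrt_sq hs.le]
  refine (((Real.hasDerivAt_arccos (by linarith) (by linarith)).comp s
    inner_hasDerivAt).div_const _).congr_deriv ?_
  rw [sqrt_eq]
  field_simp
  rw [Real.sq_sqrt (by positivity)]

theorem arccosQuot_two_mul_sub_one {x : ℝ} (hx : |x| < 1) :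
    arccosQuot (2 * (x - 1) : ℝ) = (Real.arccos x / √(2 * (1 - x)) : ℝ) := by
  have one_sub_pos : 0 < 1 - x := by linarith [(abs_lt.1 hx).2]
  have one_sub_lt : 1 - x < 2 := by linarith [(abs_lt.1 hx).1]
  have primitive_hasDerivAt : ∀ s ∈ Set.Ioo (0 : ℝ) 1,
      HasDerivAt (fun s : ℝ => ((Real.arccos (1 - (1 - x) * s ^ 2) / √(2 * (1 - x)) : ℝ) : ℂ))
        ((1 + ((2 * (x - 1) : ℝ) : ℂ) * (s : ℂ) ^ 2 / 4) ^ (-(1 / 2) : ℂ)) s := by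
    intro s hs
    have hus : (1 - x) * s ^ 2 < 2 := by nlinarith [pow_le_one₀ hs.1.le hs.2.le (n := 2)]
    have base_nonneg : 0 ≤ 1 - (1 - x) * s ^ 2 / 2 := by linarith
    refine (hasDerivAt_arccos_one_sub_mul_sq one_sub_pos hs.1 hus).ofReal_comp.congr_deriv ?_
    rw [Real.sqrt_eq_rpow, ← Real.rpow_neg base_nonneg, ofReal_cpow base_nonneg]
    push_cast
    ring_nf
  rw [arccosQuot, intervalIntegral.integral_eq_sub_of_hasDerivAt_of_le zero_le_one ?_
    primitive_hasDerivAt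
    (intervalIntegrable_one_add_mul_sq_div_four_cpow _ (two_mul_sub_one_mem_ball hx))]
  · simp
  · fun_prop

/-- The holomorphic function `arccosQuot ^ (2 α)` on the disc of radius `4`. -/
noncomputable def arccosQuotPow (α : ℝ) (y : ℂ) : ℂ :=
  exp (2 * α * log (arccosQuot y))

theorem hasDerivAt_arccosQuotPow (α : ℝ) {y : ℂ} (hy : y ∈ Metric.ball (0 : ℂ) 4) :
    HasDerivAt (arccosQuotPow α)
      (arccosQuotPow α y * (2 * α * (deriv arccosQuot y / arccosQuot y))) y :=
  (((hasDerivAt_arccosQuot hy).differentiableAt.hasDerivAt.clog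
    (arccosQuot_mem_slitPlane hy)).const_mul _).cexp

theorem differentiableOn_arccosQuotPow (α : ℝ) :
    DifferentiableOn ℂ (arccosQuotPow α) (Metric.ball 0 4) :=
  fun _ hy => (hasDerivAt_arccosQuotPow α hy).differentiableAt.differentiableWithinAt

theorem arccosQuotPow_zero (α : ℝ) : arccosQuotPow α 0 = 1 := by
  simp [arccosQuotPow, arccosQuot_zero]

theorem arccosQuotPow_ode (α : ℝ) {y : ℂ} (hy : y ∈ Metric.ball (0 : ℂ) 4) :
    deriv (arccosQuotPow α) y * arccosQuot y ^ 2 =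
      α * deriv (fun y => arccosQuot y ^ 2) y * arccosQuotPow α y := by
  have quot_ne_zero : arccosQuot y ≠ 0 := slitPlane_ne_zero (arccosQuot_mem_slitPlane hy)
  have sq_hasDerivAt : HasDerivAt (fun y => arccosQuot y ^ 2) _ y :=
    (hasDerivAt_arccosQuot hy).differentiableAt.hasDerivAt.pow 2
  rw [(hasDerivAt_arccosQuotPow α hy).deriv, sq_hasDerivAt.deriv]
  push_cast
  have div_mul_quot : deriv arccosQuot y / arccosQuot y * arccosQuot y = deriv arccosQuot y :=
    div_mul_cancel₀ _ quot_ne_zero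
  linear_combination (2 * α * arccosQuotPow α y * arccosQuot y) * div_mul_quot

theorem arccosQuotPow_two_mul_sub_one (α : ℝ) {x : ℝ} (hx : |x| < 1) :
    arccosQuotPow α (2 * (x - 1) : ℝ) = ((Real.arccos x ^ 2 / (2 * (1 - x))) ^ α : ℝ) := by
  have hx1 : x < 1 := (abs_lt.1 hx).2
  have sqrt_pos : 0 < √(2 * (1 - x)) := Real.sqrt_pos.2 (by linarith)
  have quot_pos : 0 < Real.arccos x / √(2 * (1 - x)) := div_pos (Real.arccos_pos.2 hx1) sqrt_pos
  have sq_eq : Real.arccos x ^ 2 / (2 * (1 - x)) = (Real.arccos x / √(2 * (1 - x))) ^ 2 := by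
    rw [div_pow, Real.sq_sqrt (by linarith)]
  rw [arccosQuotPow, arccosQuot_two_mul_sub_one hx, ← ofReal_log quot_pos.le, sq_eq,
    Real.rpow_def_of_pos (pow_pos quot_pos 2), Real.log_pow]
  push_cast
  ring_nf

end ArccosQuot

section Expansion

open PowerSeries

theorem analyticAt_arccosQuot : AnalyticAt ℂ arccosQuot 0 :=
  differentiableOn_arccosQuot.analyticAt (Metric.ball_mem_nhds 0 four_pos)

theorem analyticAt_arccosQuotPow (α : ℝ) : AnalyticAt ℂ (arccosQuotPow α) 0 :=
  (differentiableOn_arccosQuotPow α).analyticAt (Metric.ball_mem_nhds 0 four_pos)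

theorem taylorPowerSeries_arccosQuot_ode :
    (X + 4) * (taylorPowerSeries arccosQuot +
      2 * (X * d⁄dX ℂ (taylorPowerSeries arccosQuot))) ^ 2 = 4 := by
  have analytic := analyticAt_arccosQuot
  have ode : (fun y => (y + 4) * (arccosQuot y + 2 * (y * deriv arccosQuot y)) ^ 2) =ᶠ[𝓝 0]
      fun _ => 4 :=
    Filter.mem_of_superset (Metric.ball_mem_nhds 0 four_pos) fun _ hy => arccosQuot_ode hy
  have series_ode := taylorPowerSeries.congr ode
  rw [taylorPowerSeries.mul, taylorPowerSeries.sq, taylorPowerSeries.add, taylorPowerSeries.add,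
    taylorPowerSeries.mul, taylorPowerSeries.mul] at series_ode
  · simpa only [taylorPowerSeries.const, taylorPowerSeries.id, taylorPowerSeries.derivative,
      map_ofNat] using series_ode
  all_goals fun_prop

theorem taylorPowerSeries_arccosQuotPow_ode (α : ℝ) :
    d⁄dX ℂ (taylorPowerSeries (arccosQuotPow α)) * taylorPowerSeries arccosQuot ^ 2 =
      C (α : ℂ) * d⁄dX ℂ (taylorPowerSeries arccosQuot ^ 2) *
        taylorPowerSeries (arccosQuotPow α) := by
  have analytic := analyticAt_arccosQuot
  have analytic_pow := analyticAt_arccosQuotPow α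
  have ode : (fun y => deriv (arccosQuotPow α) y * arccosQuot y ^ 2) =ᶠ[𝓝 0]
      fun y => α * deriv (fun y => arccosQuot y ^ 2) y * arccosQuotPow α y :=
    Filter.mem_of_superset (Metric.ball_mem_nhds 0 four_pos) fun _ hy => arccosQuotPow_ode α hy
  simpa (disch := fun_prop) only [taylorPowerSeries.mul, taylorPowerSeries.sq,
    taylorPowerSeries.const, taylorPowerSeries.derivative] using taylorPowerSeries.congr ode

theorem inv_factorial_mul_iteratedDeriv_arccosQuotPow (α : ℝ) (n : ℕ) :
    (n.factorial : ℂ)⁻¹ * iteratedDeriv n (arccosQuotPow α) 0 = arccosTaylorCoeff α n := by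
  rw [← taylorPowerSeries.coeff]
  exact coeff_eq_arccosTaylorCoeff α taylorPowerSeries_arccosQuot_ode
    (by rw [taylorPowerSeries.constantCoeff, arccosQuot_zero])
    (by rw [taylorPowerSeries.constantCoeff, arccosQuotPow_zero])
    (taylorPowerSeries_arccosQuotPow_ode α) n

theorem hasSum_arccosTaylorCoeff_mul_pow (α : ℝ) {x : ℝ} (hx : |x| < 1) :
    HasSum (fun n => arccosTaylorCoeff α n * (2 * (x - 1)) ^ n)
      ((Real.arccos x ^ 2 / (2 * (1 - x))) ^ α) := by
  have taylor := Complex.hasSum_taylorSeries_on_ball (differentiableOn_arccosQuotPow α)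
    (two_mul_sub_one_mem_ball hx)
  rw [arccosQuotPow_two_mul_sub_one α hx] at taylor
  refine Complex.hasSum_ofReal.1 (taylor.congr_fun fun n => ?_)
  rw [smul_eq_mul, smul_eq_mul, sub_zero, mul_left_comm,
    inv_factorial_mul_iteratedDeriv_arccosQuotPow]
  push_cast
  ring

end Expansion

section LeftLimit

theorem tendsto_iteratedDeriv_nhdsLT_of_hasSum {f : ℝ → ℝ} {a : ℕ → ℝ} {c r : ℝ} (hr : 0 < r)
    (hf : ∀ x ∈ Set.Ioo (c - r) c, HasSum (fun n => a n * (x - c) ^ n) (f x)) (n : ℕ) :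
    Tendsto (iteratedDeriv n f) (𝓝[<] c) (𝓝 (n.factorial * a n)) := by
  let p := FormalMultilinearSeries.ofScalars ℝ a
  have p_apply (k : ℕ) (y : ℝ) : p k (fun _ => y) = a k * y ^ k :=
    FormalMultilinearSeries.ofScalars_apply_eq a y k
  have radius_pos : 0 < p.radius := by
    refine (ENNReal.ofReal_pos.2 (half_pos hr)).trans_le (p.le_radius_of_summable_norm ?_)
    refine (hf (c - r / 2) ⟨by linarith, by linarith⟩).summable.norm.congr fun k => ?_
    simp [p, abs_of_pos hr, max_eq_left (half_pos hr).le]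
  let g : ℝ → ℝ := fun x => p.sum (x - c)
  have g_series : HasFPowerSeriesOnBall g p c p.radius := by
    simpa using (p.hasFPowerSeriesOnBall radius_pos).comp_sub c
  have f_eq_g : Set.EqOn f g (Set.Ioo (c - r) c) := fun x hx => by
    simp only [g, FormalMultilinearSeries.sum, p_apply, (hf x hx).tsum_eq]
  have iteratedDeriv_g : iteratedDeriv n g c = n.factorial * a n := by
    rw [iteratedDeriv_eq_iteratedFDeriv, ← g_series.factorial_smul 1 n, p_apply, one_pow, mul_one,
      nsmul_eq_mul]
  have g_continuousAt : ContinuousAt (iteratedDeriv n g) c := by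
    rw [iteratedDeriv_eq_iterate]
    exact (g_series.analyticAt.iterated_deriv n).continuousAt
  rw [← iteratedDeriv_g]
  refine (g_continuousAt.tendsto.mono_left nhdsWithin_le_nhds).congr' ?_
  filter_upwards [Ioo_mem_nhdsLT (sub_lt_self c hr)] with x hx
  exact ((f_eq_g.symm.eventuallyEq_of_mem (isOpen_Ioo.mem_nhds hx)).iteratedDeriv_eq n)

end LeftLimit

theorem theorem5p2 (α : ℝ) :
    (∀ x : ℝ, |x| < 1 →
      Summable (fun n : ℕ => arccosCoeff α (n + 1) * (2 * (x - 1)) ^ (n + 1)) ∧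
      (Real.arccos x ^ 2 / (2 * (1 - x))) ^ α =
        1 + ∑' n : ℕ, arccosCoeff α (n + 1) * (2 * (x - 1)) ^ (n + 1)) ∧
    (∀ n : ℕ, 1 ≤ n →
      Tendsto (iteratedDeriv n fun x : ℝ => (Real.arccos x ^ 2 / (2 * (1 - x))) ^ α) (𝓝[<] 1)
        (𝓝 ((Nat.factorial n : ℝ) * (2 ^ n * arccosCoeff α n)))) := by
  refine ⟨fun x hx => ?_, fun n hn => ?_⟩
  · have tail : HasSum (fun n : ℕ => arccosCoeff α (n + 1) * (2 * (x - 1)) ^ (n + 1))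
        ((Real.arccos x ^ 2 / (2 * (1 - x))) ^ α - 1) := by
      simpa [arccosTaylorCoeff] using
        (hasSum_nat_add_iff' 1).2 (hasSum_arccosTaylorCoeff_mul_pow α hx)
    exact ⟨tail.summable, by rw [tail.tsum_eq, add_sub_cancel]⟩
  · have coeff_eq : arccosTaylorCoeff α n = arccosCoeff α n :=
      if_neg (Nat.one_le_iff_ne_zero.1 hn)
    rw [← coeff_eq]
    refine tendsto_iteratedDeriv_nhdsLT_of_hasSum (a := fun n => 2 ^ n * arccosTaylorCoeff α n)
      two_pos (fun x hx => ?_) n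
    simpa only [mul_pow, mul_left_comm, mul_assoc] using
      hasSum_arccosTaylorCoeff_mul_pow α (abs_lt.2 ⟨by linarith [hx.1], hx.2⟩)
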